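/- The rank of a group is the minimal cardinality of a generating set. A group $\Gamma$ is called $k$-free, for an integer $k\ge 0$, if every subgroup of $\Gamma$ having rank at most $k$ is a free group. The local rank of a group $G$ is the smallest non-negative integer $r$ such that every finitely generated subgroup of $G$ is contained in a subgroup of $G$ having rank $r$; if no such $r$ exists, the local rank of $G$ is infinite. Let $A$ and $B$ be subgroups of a $4$-free group $\Gamma$. Suppose that $A$ and $B$ both have local rank $2$ and that the subgroup $A\cap B$ is non-abelian. Then the subgroup $\langle A,B\rangle$ of $\Gamma$ generated by $A$ and $B$ has local rank $2$. -/

import Mathlib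

/-- The group `G` has finite rank equal to `r`: it is finitely generated, and the minimal
cardinality of a generating set of `G` is `r`. -/
def HasRank (G : Type*) [Group G] (r : ℕ) : Prop :=
  ∃ _ : Group.FG G, Group.rank G = r

/-- The group `Γ` is `k`-free: every subgroup of `Γ` having rank at most `k` is a free group. -/
def IsKFree (k : ℕ) (Γ : Type*) [Group Γ] : Prop :=
  ∀ (H : Subgroup Γ) (r : ℕ), HasRank H r → r ≤ k → IsFreeGroup H

/-- The local rank of the group `G`: the smallest natural number `r` such that every finitely
generated subgroup of `G` is contained in a subgroup of `G` having rank `r`, and `⊤` (infinity)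
if there is no such number. -/
noncomputable def localRank (G : Type*) [Group G] : ℕ∞ :=
  ⨅ (r : ℕ) (_ : ∀ C : Subgroup G, C.FG → ∃ D : Subgroup G, C ≤ D ∧ HasRank D r), (r : ℕ∞)

/-! A finite subset of `A ⊔ B` lies in `⟨a, b⟩ ⊔ ⟨c, d⟩` with `⟨a, b⟩ ≤ A` and `⟨c, d⟩ ≤ B`, and
both pairs can be chosen so that their spans contain two fixed non-commuting elements of `A ⊓ B`. By
4-freeness `⟨a, b, c, d⟩` is free, so everything reduces to one fact: a free group generated by `a,
b, c, d` in which `⟨a, b⟩ ∩ ⟨c, d⟩` is non-abelian has rank at most two.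

Suppose there are three distinct basis elements, and embed the group in noncommutative power series
by `x ↦ exp x`. An element `u` of the intersection has two expressions for `u - 1`, one through `a -
1, b - 1` and one through `c - 1, d - 1`; their difference is a left linear relation among the four
series. The linear terms of these series span a space of dimension at least three, so all relations
are left multiples of a single one. Hence `u - 1 = q z` with `z` independent of `u` and without
constant term (`exists_common_right_divisor`).

Since exponentials are group-like, the lowest term of `u - 1` is primitive. A primitive polynomial
is irreducible (`mem_homog_zero_or_of_primitive_mul`): it acts on a commutative polynomial ring as a
derivation, and orders of differential operators on a domain of characteristic zero add up. So `q`
starts with a constant, and every `u ≠ 1` in the intersection has the order of `z` (`order_aug_eq`).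
A non-trivial commutator would have at least twice this positive order, so the intersection is
abelian. -/

/-! ### Differential operators on a commutative domain -/

section DifferentialOperators

variable {O : Type*} [CommRing O] [Algebra ℚ O]

/-- The commutator of an operator with multiplication by `h`. -/
noncomputable def adMul (h : O) : Module.End ℚ (Module.End ℚ O) :=
  LinearMap.mulLeft ℚ (Algebra.lmul ℚ O h) - LinearMap.mulRight ℚ (Algebra.lmul ℚ O h)

theorem adMul_apply (h : O) (Q : Module.End ℚ O) :
    adMul h Q = Algebra.lmul ℚ O h * Q - Q * Algebra.lmul ℚ O h := rfl

theorem adMul_apply_apply (h : O) (Q : Module.End ℚ O) (f : O) :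
    adMul h Q f = h * Q f - Q (h * f) := rfl

theorem adMul_mul (h : O) (P Q : Module.End ℚ O) :
    adMul h (P * Q) = adMul h P * Q + P * adMul h Q := by
  simp only [adMul_apply, sub_mul, mul_sub, mul_assoc]; abel

theorem adMul_add_smul (h g : O) (l : ℚ) : adMul (h + l • g) = adMul h + l • adMul g := by
  ext Q f
  simp [adMul_apply_apply, add_mul, smul_sub]
  ring

theorem adMul_commute (h g : O) : Commute (adMul h) (adMul g) := by
  ext Q f
  simp only [Module.End.mul_apply, adMul_apply_apply, mul_sub]
  rw [mul_left_comm h g (Q f), mul_left_comm h g f]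
  ring

/-- `IsDiffOp n Q`: the operator `Q` is a differential operator of order at most `n`. -/
def IsDiffOp : ℕ → Module.End ℚ O → Prop
  | 0, Q => ∀ h, adMul h Q = 0
  | n + 1, Q => ∀ h, IsDiffOp n (adMul h Q)

theorem IsDiffOp.zero (n : ℕ) : IsDiffOp n (0 : Module.End ℚ O) := by
  induction n with
  | zero => intro h; simp
  | succ n ih => intro h; simpa using ih

theorem IsDiffOp.succ {n : ℕ} {Q : Module.End ℚ O} (hQ : IsDiffOp n Q) : IsDiffOp (n + 1) Q := by
  induction n generalizing Q with
  | zero => intro h; rw [hQ h]; exact .zero 0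
  | succ n ih => intro h; exact ih (hQ h)

theorem IsDiffOp.mono {m n : ℕ} (hmn : m ≤ n) {Q : Module.End ℚ O} (hQ : IsDiffOp m Q) :
    IsDiffOp n Q := by
  induction hmn with
  | refl => exact hQ
  | step _ ih => exact ih.succ

theorem IsDiffOp.add {n : ℕ} {P Q : Module.End ℚ O} (hP : IsDiffOp n P) (hQ : IsDiffOp n Q) :
    IsDiffOp n (P + Q) := by
  induction n generalizing P Q with
  | zero => intro h; rw [map_add, hP h, hQ h, add_zero]
  | succ n ih => intro h; rw [map_add]; exact ih (hP h) (hQ h)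

theorem IsDiffOp.smul {n : ℕ} {P : Module.End ℚ O} (l : ℚ) (hP : IsDiffOp n P) :
    IsDiffOp n (l • P) := by
  induction n generalizing P with
  | zero => intro h; rw [map_smul, hP h, smul_zero]
  | succ n ih => intro h; rw [map_smul]; exact ih (hP h)

/-- By the Leibniz rule for `adMul h`, each summand lowers one of the two orders; if that order is
already zero, the summand vanishes. -/
theorem IsDiffOp.mul {m n : ℕ} {P Q : Module.End ℚ O} (hP : IsDiffOp m P) (hQ : IsDiffOp n Q) :
    IsDiffOp (m + n) (P * Q) := by
  induction hk : m + n generalizing m n P Q with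
  | zero =>
    obtain ⟨rfl, rfl⟩ : m = 0 ∧ n = 0 := by omega
    intro h
    rw [adMul_mul, hP h, hQ h]; simp
  | succ k ih =>
    intro h
    rw [adMul_mul]
    refine IsDiffOp.add ?_ ?_
    · cases m with
      | zero => rw [hP h, zero_mul]; exact .zero k
      | succ m => exact ih (hP h) hQ (by omega)
    · cases n with
      | zero => rw [hQ h, mul_zero]; exact .zero k
      | succ n => exact ih hP (hQ h) (by omega)

theorem IsDiffOp.pow_adMul {n m : ℕ} {Q : Module.End ℚ O} (hQ : IsDiffOp (n + m) Q) (h : O) :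
    IsDiffOp n ((adMul h ^ m) Q) := by
  induction m generalizing Q with
  | zero => exact hQ
  | succ m ih =>
    rw [pow_succ, Module.End.mul_apply]
    exact ih (hQ h)

theorem IsDiffOp.pow_succ_adMul {m : ℕ} {Q : Module.End ℚ O} (hQ : IsDiffOp m Q) (h : O) :
    (adMul h ^ (m + 1)) Q = 0 := by
  rw [pow_succ', Module.End.mul_apply]
  exact (IsDiffOp.pow_adMul (n := 0) (by simpa using hQ) h) h

theorem IsDiffOp.apply_eq {Q : Module.End ℚ O} (hQ : IsDiffOp 0 Q) (f : O) : Q f = f * Q 1 := by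
  have := congrArg (fun P : Module.End ℚ O => P 1) (hQ f)
  simp only [adMul_apply_apply, mul_one, LinearMap.zero_apply] at this
  exact (sub_eq_zero.1 this).symm

/-- A polynomial family of vectors with a non-vanishing coefficient vanishes finitely often. -/
theorem finite_setOf_add_smul_pow_apply_eq_zero {M : Type*} [AddCommGroup M] [Module ℚ M]
    {S T : Module.End ℚ M} (hST : Commute S T) (v : M) {n i : ℕ} (hi : i ≤ n)
    (hv : (T ^ i) ((S ^ (n - i)) v) ≠ 0) : {l : ℚ | ((S + l • T) ^ n) v = 0}.Finite := by
  obtain ⟨ψ, hψ⟩ : ∃ ψ : Module.Dual ℚ M, ψ ((T ^ i) ((S ^ (n - i)) v)) ≠ 0 := by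
    by_contra! h
    exact hv ((Module.forall_dual_apply_eq_zero_iff ℚ _).1 h)
  -- The binomial expansion of `ψ ((S + l • T) ^ n v)` as a polynomial in `l`; its coefficient at
  -- `i` is non-zero by the choice of `ψ`.
  let p : Polynomial ℚ := ∑ j ∈ Finset.range (n + 1),
    Polynomial.monomial j ((n.choose j : ℚ) * ψ ((T ^ j) ((S ^ (n - j)) v)))
  have hp : p ≠ 0 := by
    intro h
    have := congrArg (Polynomial.coeff · i) h
    simp only [p, Polynomial.finsetSum_coeff, Polynomial.coeff_monomial, Polynomial.coeff_zero,
      Finset.sum_ite_eq', Finset.mem_range] at this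
    rw [if_pos (by omega)] at this
    rcases mul_eq_zero.1 this with h | h
    · exact (Nat.choose_pos hi).ne' (by exact_mod_cast h)
    · exact hψ h
  refine (p.rootSet_finite ℚ).subset fun l hl => ?_
  rw [Polynomial.mem_rootSet]
  refine ⟨hp, ?_⟩
  have hl' : ψ (((S + l • T) ^ n) v) = 0 := by
    rw [show ((S + l • T) ^ n) v = 0 from hl, map_zero]
  rw [add_comm, (hST.symm.smul_left l).add_pow, LinearMap.sum_apply, map_sum] at hl'
  rw [Polynomial.coe_aeval_eq_eval, Polynomial.eval_finsetSum, ← hl']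
  refine Finset.sum_congr rfl fun j _ => ?_
  rw [Polynomial.eval_monomial, mul_assoc, Module.End.mul_apply, Module.End.mul_apply,
    Module.End.natCast_apply, smul_pow, LinearMap.smul_apply, map_nsmul, map_nsmul, map_smul,
    map_nsmul, nsmul_eq_mul, smul_eq_mul]
  ring

/-- Polarization: a non-zero iterated commutator with several functions yields one with a single
function. If `h` works for `adMul g Q`, then `g + l • h` works for `Q` for all but finitely many
`l`. -/
theorem IsDiffOp.exists_pow_adMul_ne_zero {n : ℕ} {Q : Module.End ℚ O} (hQ : ¬ IsDiffOp n Q)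
    (hQ' : IsDiffOp (n + 1) Q) : ∃ h, (adMul h ^ (n + 1)) Q ≠ 0 := by
  induction n generalizing Q with
  | zero => simpa [IsDiffOp] using hQ
  | succ n ih =>
    obtain ⟨g, hg⟩ : ∃ g, ¬ IsDiffOp n (adMul g Q) := by simpa [IsDiffOp] using hQ
    obtain ⟨h, hh⟩ := ih hg (hQ' g)
    have hfin := finite_setOf_add_smul_pow_apply_eq_zero (adMul_commute g h) Q
      (n := n + 1 + 1) (i := n + 1) (by omega) (by simpa using hh)
    obtain ⟨l, hl⟩ := hfin.exists_notMem
    exact ⟨g + l • h, by rw [adMul_add_smul]; exact hl⟩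

/-- In the Leibniz expansion every other term contains a vanishing power. The constant is a binomial
coefficient, built by Pascal's recursion; only its positivity is needed. -/
theorem exists_pow_apply_mul_eq_smul {A : Type*} [Ring A] [Algebra ℚ A] (D : Module.End ℚ A)
    (hD : ∀ x y, D (x * y) = D x * y + x * D y) {a b : ℕ} {x y : A}
    (hx : (D ^ (a + 1)) x = 0) (hy : (D ^ (b + 1)) y = 0) :
    ∃ c : ℕ, 0 < c ∧ (D ^ (a + b)) (x * y) = c • ((D ^ a) x * (D ^ b) y) := by
  induction hk : a + b generalizing a b x y with
  | zero =>
    obtain ⟨rfl, rfl⟩ : a = 0 ∧ b = 0 := by omega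
    exact ⟨1, one_pos, by simp⟩
  | succ k ih =>
    have hx' : (D ^ a) (D x) = 0 := by rwa [pow_succ] at hx
    have hy' : (D ^ b) (D y) = 0 := by rwa [pow_succ] at hy
    have key : (D ^ (k + 1)) (x * y) = (D ^ k) (D x * y) + (D ^ k) (x * D y) := by
      rw [pow_succ, Module.End.mul_apply, hD, map_add]
    rw [key]
    rcases a with _ | a
    · rcases b with _ | b
      · omega
      · obtain ⟨c, hc, h⟩ := ih hx hy' (by omega)
        refine ⟨c, hc, ?_⟩
        have : D x = 0 := by simpa using hx
        rw [h, this, zero_mul, map_zero, zero_add, pow_succ D b, Module.End.mul_apply]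
    · obtain ⟨c, hc, h⟩ := ih hx' hy (by omega)
      rcases b with _ | b
      · refine ⟨c, hc, ?_⟩
        have : D y = 0 := by simpa using hy
        rw [h, this, mul_zero, map_zero, add_zero, pow_succ D a, Module.End.mul_apply]
      · obtain ⟨c', hc', h'⟩ := ih hx hy' (by omega)
        refine ⟨c + c', by omega, ?_⟩
        rw [h, h', add_smul, pow_succ D a, pow_succ D b, Module.End.mul_apply,
          Module.End.mul_apply]

/-- Orders of differential operators on a domain add up; here is the case of total order one. -/
theorem IsDiffOp.zero_or_zero_of_mul [IsDomain O] {m n : ℕ} {P Q : Module.End ℚ O}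
    (hP : IsDiffOp m P) (hQ : IsDiffOp n Q) (hPQ : IsDiffOp 1 (P * Q)) :
    IsDiffOp 0 P ∨ IsDiffOp 0 Q := by
  have exact_order : ∀ {m : ℕ} {P : Module.End ℚ O}, IsDiffOp m P → ¬ IsDiffOp 0 P →
      ∃ a, IsDiffOp (a + 1) P ∧ ¬ IsDiffOp a P := by
    intro m P hP h0
    induction m with
    | zero => exact absurd hP h0
    | succ m ih =>
      by_cases h : IsDiffOp m P
      · exact ih h
      · exact ⟨m, hP, h⟩
  by_contra! H
  obtain ⟨a, ha, ha'⟩ := exact_order hP H.1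
  obtain ⟨b, hb, hb'⟩ := exact_order hQ H.2
  obtain ⟨f, hf⟩ := IsDiffOp.exists_pow_adMul_ne_zero ha' ha
  obtain ⟨g, hg⟩ := IsDiffOp.exists_pow_adMul_ne_zero hb' hb
  -- A single function `f + l • g` must detect the exact orders of both operators; each excludes
  -- only finitely many `l`.
  have h1 := finite_setOf_add_smul_pow_apply_eq_zero (adMul_commute f g) P
    (n := a + 1) (i := 0) (by omega) (by simpa using hf)
  have h2 := finite_setOf_add_smul_pow_apply_eq_zero (adMul_commute f g) Q
    (n := b + 1) (i := b + 1) (by omega) (by simpa using hg)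
  obtain ⟨l, hl⟩ := (h1.union h2).exists_notMem
  simp only [Set.mem_union, Set.mem_ofPred_eq, not_or, ← adMul_add_smul] at hl
  set h := f + l • g
  obtain ⟨c, hc, hcP⟩ := exists_pow_apply_mul_eq_smul (adMul h) (adMul_mul h)
    (ha.pow_succ_adMul h) (hb.pow_succ_adMul h)
  -- The exact orders are `a + 1` and `b + 1`, so at least two commutators are taken, which kills an
  -- operator of order one.
  have hz : (adMul h ^ (a + 1 + (b + 1))) (P * Q) = 0 := by
    rw [show a + 1 + (b + 1) = (a + b) + (1 + 1) by ring, pow_add, Module.End.mul_apply,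
      hPQ.pow_succ_adMul h, map_zero]
  rw [hz] at hcP
  have hP0 : IsDiffOp 0 ((adMul h ^ (a + 1)) P) := IsDiffOp.pow_adMul (by simpa using ha) h
  have hQ0 : IsDiffOp 0 ((adMul h ^ (b + 1)) Q) := IsDiffOp.pow_adMul (by simpa using hb) h
  have ne_one : ∀ {Q : Module.End ℚ O}, IsDiffOp 0 Q → Q ≠ 0 → Q 1 ≠ 0 := by
    intro Q hQ hne h
    exact hne (LinearMap.ext fun x => by rw [hQ.apply_eq, h, mul_zero, LinearMap.zero_apply])
  have := congrArg (fun P : Module.End ℚ O => P 1) hcP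
  simp only [LinearMap.zero_apply, LinearMap.smul_apply, Module.End.mul_apply] at this
  rw [hP0.apply_eq] at this
  have hne := mul_ne_zero (ne_one hQ0 hl.2) (ne_one hP0 hl.1)
  rw [← Nat.cast_smul_eq_nsmul ℚ] at this
  rcases smul_eq_zero.1 this.symm with h | h
  · exact hc.ne' (by exact_mod_cast h)
  · exact hne h

end DifferentialOperators

section FreeGroups

open scoped TensorProduct Nat PowerSeries

/-! ### Noncommutative polynomials -/

/-- Noncommutative polynomials with rational coefficients. -/
abbrev NCPoly (α : Type*) := MonoidAlgebra ℚ (FreeMonoid α)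

namespace NCPoly

variable {α : Type*}

/-- The variable of `NCPoly α` indexed by `x`. -/
noncomputable def var (x : α) : NCPoly α := MonoidAlgebra.of ℚ _ (FreeMonoid.of x)

theorem ext_coeff {r s : NCPoly α} (h : ∀ w, r.coeff w = s.coeff w) : r = s :=
  MonoidAlgebra.ext (Finsupp.ext h)

theorem var_def (x : α) : var x = MonoidAlgebra.single (FreeMonoid.of x) 1 := rfl

theorem induction_on {motive : NCPoly α → Prop} (r : NCPoly α) (one : motive 1)
    (var_mul : ∀ x r, motive r → motive (var x * r))
    (add : ∀ r s, motive r → motive s → motive (r + s))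
    (smul : ∀ (l : ℚ) r, motive r → motive (l • r)) : motive r := by
  refine MonoidAlgebra.induction_on r (fun w => ?_) add smul
  induction w using FreeMonoid.inductionOn' with
  | one => rw [map_one]; exact one
  | of_mul x w ih => rw [map_mul]; exact var_mul x _ ih

/-- Homogeneous noncommutative polynomials of degree `n`. -/
def homog (α : Type*) (n : ℕ) : Submodule ℚ (NCPoly α) where
  carrier := {r | ∀ w, r.coeff w ≠ 0 → w.length = n}
  add_mem' {r s} hr hs w hw := by
    by_cases h : r.coeff w = 0
    · exact hs w fun h' => hw (by simp [h, h'])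
    · exact hr w h
  zero_mem' w hw := absurd rfl hw
  smul_mem' l r hr w hw := hr w fun h => hw (by simp [h])

theorem single_mem_homog (w : FreeMonoid α) (l : ℚ) :
    MonoidAlgebra.single w l ∈ homog α w.length := by
  classical
  intro v hv
  rw [MonoidAlgebra.coeff_single, Finsupp.single_apply] at hv
  split_ifs at hv with h
  · rw [h]
  · exact absurd rfl hv

theorem var_mem_homog (x : α) : var x ∈ homog α 1 := single_mem_homog (FreeMonoid.of x) 1

theorem one_mem_homog : (1 : NCPoly α) ∈ homog α 0 := single_mem_homog 1 1

theorem mul_mem_homog {m n : ℕ} {r s : NCPoly α} (hr : r ∈ homog α m) (hs : s ∈ homog α n) :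
    r * s ∈ homog α (m + n) := by
  classical
  rw [MonoidAlgebra.mul_def]
  refine Submodule.sum_mem _ fun v hv => Submodule.sum_mem _ fun w hw => ?_
  have := single_mem_homog (v * w) (r.coeff v * s.coeff w)
  rwa [FreeMonoid.length_mul, hr v (Finsupp.mem_support_iff.1 hv),
    hs w (Finsupp.mem_support_iff.1 hw)] at this

theorem eq_of_mem_homog {m n : ℕ} {r : NCPoly α} (hm : r ∈ homog α m) (hn : r ∈ homog α n)
    (hr : r ≠ 0) : m = n := by
  obtain ⟨w, hw⟩ : ∃ w, r.coeff w ≠ 0 := by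
    by_contra! h
    exact hr (ext_coeff fun w => h w)
  rw [← hm w hw, ← hn w hw]

theorem eq_smul_one_of_mem_homog_zero {r : NCPoly α} (hr : r ∈ homog α 0) :
    r = r.coeff 1 • (1 : NCPoly α) := by
  classical
  refine ext_coeff fun w => ?_
  rw [MonoidAlgebra.coeff_smul_apply, MonoidAlgebra.one_def, MonoidAlgebra.coeff_single,
    Finsupp.single_apply]
  split_ifs with h
  · rw [← h]; simp
  · by_contra h'
    exact h (FreeMonoid.length_eq_zero.1 (hr w (by simpa using h'))).symm

/-! ### Noncommutative polynomials as differential operators -/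

/-- The derivation by which a variable acts on commutative polynomials in the words. -/
noncomputable def varDerivation (x : α) :
    Derivation ℚ (MvPolynomial (FreeMonoid α) ℚ) (MvPolynomial (FreeMonoid α) ℚ) :=
  MvPolynomial.mkDerivation ℚ fun w => MvPolynomial.X (FreeMonoid.of x * w)

/-- The action of noncommutative polynomials on commutative polynomials in the words. -/
noncomputable def act : NCPoly α →ₐ[ℚ] Module.End ℚ (MvPolynomial (FreeMonoid α) ℚ) :=
  MonoidAlgebra.lift ℚ _ _ (FreeMonoid.lift fun x => (varDerivation x).toLinearMap)

theorem act_var (x : α) : act (var x) = (varDerivation x).toLinearMap := by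
  simp [act, var]

theorem act_one_right (r : NCPoly α) : act r 1 = r.coeff 1 • 1 := by
  classical
  induction r using MonoidAlgebra.induction_on with
  | of w =>
    induction w using FreeMonoid.inductionOn' with
    | one => rw [map_one (MonoidAlgebra.of ℚ _), map_one act]; simp
    | of_mul x w ih =>
      rw [map_mul, map_mul, Module.End.mul_apply, ih, map_smul, ← var, act_var]
      have : (FreeMonoid.of x * w : FreeMonoid α) ≠ 1 := by
        intro h
        have := congrArg FreeMonoid.length h
        simp [FreeMonoid.length_mul] at this
      simp [var_def, MonoidAlgebra.single_mul_single, Finsupp.single_apply, this]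
  | add r s hr hs => simp [hr, hs, add_smul]
  | smul l r hr => simp [hr, mul_smul]

/-- The variable of the empty word recovers all coefficients of `r`, so the action is faithful. -/
theorem act_X_one (r : NCPoly α) :
    act r (MvPolynomial.X 1) = r.coeff.sum fun w l => l • MvPolynomial.X w := by
  classical
  induction r using MonoidAlgebra.induction_on with
  | of w =>
    rw [MonoidAlgebra.of_apply, MonoidAlgebra.coeff_single, Finsupp.sum_single_index (by simp),
      one_smul, ← MonoidAlgebra.of_apply]
    induction w using FreeMonoid.inductionOn' with
    | one => rw [map_one (MonoidAlgebra.of ℚ _), map_one act]; simp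
    | of_mul x w ih =>
      rw [map_mul, map_mul, Module.End.mul_apply, ih, ← var, act_var]
      simp [varDerivation, MvPolynomial.mkDerivation_X]
  | add r s hr hs =>
    rw [map_add, LinearMap.add_apply, hr, hs, MonoidAlgebra.coeff_add, Finsupp.sum_add_index]
    · simp
    · intros; rw [add_smul]
  | smul l r hr =>
    rw [map_smul, LinearMap.smul_apply, hr, MonoidAlgebra.coeff_smul, Finsupp.sum_smul_index,
      Finsupp.smul_sum]
    · simp [mul_smul]
    · simp

theorem isDiffOp_one_of_leibniz {O : Type*} [CommRing O] [Algebra ℚ O] {D : Module.End ℚ O}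
    (hD : ∀ f g, D (f * g) = D f * g + f * D g) : IsDiffOp 1 D := by
  intro h g
  ext f
  simp only [adMul_apply_apply, hD, LinearMap.zero_apply]
  ring

theorem exists_isDiffOp_act (r : NCPoly α) : ∃ n, IsDiffOp n (act r) := by
  induction r using NCPoly.induction_on with
  | one => exact ⟨0, fun h => by ext; simp [adMul_apply_apply]⟩
  | var_mul x r ih =>
    obtain ⟨n, hn⟩ := ih
    refine ⟨1 + n, ?_⟩
    rw [map_mul]
    refine IsDiffOp.mul (isDiffOp_one_of_leibniz fun f g => ?_) hn
    rw [act_var]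
    simp [mul_comm, add_comm]
  | add r s hr hs =>
    obtain ⟨m, hm⟩ := hr
    obtain ⟨n, hn⟩ := hs
    rw [map_add]
    exact ⟨max m n, (hm.mono (le_max_left _ _)).add (hn.mono (le_max_right _ _))⟩
  | smul l r hr =>
    obtain ⟨m, hm⟩ := hr
    rw [map_smul]
    exact ⟨m, hm.smul l⟩

/-- An operator of order zero is multiplication by its value at `1`, here the constant term of `r`.
Comparing values at `X 1` leaves only the empty word. -/
theorem mem_homog_zero_of_isDiffOp_zero {r : NCPoly α} (hr : IsDiffOp 0 (act r)) :
    r ∈ homog α 0 := by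
  classical
  have h := hr.apply_eq (MvPolynomial.X 1)
  rw [act_X_one, act_one_right] at h
  intro w hw
  by_contra hlen
  have hw1 : (1 : FreeMonoid α) ≠ w := fun h => hlen (by rw [← h]; rfl)
  have := congrArg (MvPolynomial.coeff (Finsupp.single w 1)) h
  rw [mul_smul_comm, mul_one, Finsupp.sum, MvPolynomial.coeff_sum, MvPolynomial.coeff_smul,
    MvPolynomial.coeff_X, if_neg (by simpa [Finsupp.single_left_inj] using hw1)] at this
  simp only [MvPolynomial.coeff_smul, MvPolynomial.coeff_X, smul_eq_mul, mul_zero] at this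
  simp only [Finsupp.single_left_inj (one_ne_zero : (1 : ℕ) ≠ 0), mul_ite, mul_one,
    mul_zero, Finset.sum_ite_eq', Finsupp.mem_support_iff, ne_eq, hw, not_false_eq_true,
    if_true] at this

/-! ### Primitive elements and their irreducibility -/

/-- The comultiplication for which the variables are primitive. -/
noncomputable def comul : NCPoly α →ₐ[ℚ] NCPoly α ⊗[ℚ] NCPoly α :=
  MonoidAlgebra.lift ℚ _ _ (FreeMonoid.lift fun x => var x ⊗ₜ 1 + 1 ⊗ₜ var x)

theorem comul_var (x : α) : comul (var x) = var x ⊗ₜ[ℚ] 1 + 1 ⊗ₜ[ℚ] var x := by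
  simp [comul, var]

/-- The comultiplication encodes the Leibniz rule: this is clear for variables and passes to
products because `comul` is multiplicative. Primitive elements therefore act as derivations. -/
theorem act_mul_eq (r : NCPoly α) (f g : MvPolynomial (FreeMonoid α) ℚ) :
    act r (f * g) = LinearMap.mul' ℚ _
      (TensorProduct.map (act.toLinearMap.flip f) (act.toLinearMap.flip g) (comul r)) := by
  induction r using NCPoly.induction_on with
  | one => simp [Algebra.TensorProduct.one_def]
  | var_mul x r ih =>
    rw [map_mul act, Module.End.mul_apply, ih, map_mul (comul (α := α)), comul_var, act_var]
    generalize comul r = t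
    induction t using TensorProduct.induction_on with
    | zero => simp
    | add s t hs ht => simp only [map_add, mul_add, hs, ht]
    | tmul r s =>
      simp [add_mul, act_var]
      ring
  | add r s hr hs => simp only [map_add, LinearMap.add_apply, hr, hs]
  | smul l r hr => simp only [map_smul, LinearMap.smul_apply, hr]

/-- Primitive noncommutative polynomials are irreducible. -/
theorem mem_homog_zero_or_of_primitive_mul {q z : NCPoly α}
    (h : comul (q * z) = (q * z) ⊗ₜ[ℚ] 1 + 1 ⊗ₜ[ℚ] (q * z)) :
    q ∈ homog α 0 ∨ z ∈ homog α 0 := by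
  obtain ⟨m, hm⟩ := exists_isDiffOp_act q
  obtain ⟨n, hn⟩ := exists_isDiffOp_act z
  have h1 : IsDiffOp 1 (act q * act z) := by
    rw [← map_mul]
    refine isDiffOp_one_of_leibniz fun f g => ?_
    rw [act_mul_eq, h]
    simp
  exact (hm.zero_or_zero_of_mul hn h1).imp mem_homog_zero_of_isDiffOp_zero
    mem_homog_zero_of_isDiffOp_zero

/-! ### Left independence of linear forms -/

theorem coeff_mul_of_mem_homog_one (r : NCPoly α) {s : NCPoly α} (hs : s ∈ homog α 1)
    (w : FreeMonoid α) (x : α) :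
    (r * s).coeff (w * FreeMonoid.of x) = r.coeff w * s.coeff (FreeMonoid.of x) := by
  classical
  have key : ∀ (v : FreeMonoid α) (l : ℚ), (MonoidAlgebra.single v l * s).coeff
      (w * FreeMonoid.of x) =
        (MonoidAlgebra.single v l).coeff w * s.coeff (FreeMonoid.of x) := by
    intro v l
    by_cases hv : v = w
    · subst hv
      rw [MonoidAlgebra.coeff_single_mul_eq_mul_coeff (m₂ := FreeMonoid.of x)
        (fun m' _ => mul_right_inj v)]
      simp
    · rw [MonoidAlgebra.coeff_single, Finsupp.single_apply, if_neg hv, zero_mul]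
      by_cases hd : ∃ d, v * d = w * FreeMonoid.of x
      · obtain ⟨d, hd⟩ := hd
        rw [← hd, MonoidAlgebra.coeff_single_mul_eq_mul_coeff (m₂ := d)
          (fun m' _ => mul_right_inj v)]
        have : s.coeff d = 0 := by
          by_contra hne
          obtain ⟨y, rfl⟩ := FreeMonoid.length_eq_one.1 (hs d hne)
          exact hv (List.append_inj_left' hd rfl)
        rw [this, mul_zero]
      · exact MonoidAlgebra.coeff_single_mul_of_forall_mul_ne _ _ fun d h => hd ⟨d, h⟩
  induction r using MonoidAlgebra.induction_linear with
  | zero => simp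
  | add r t hr ht => simp [add_mul, hr, ht]
  | single v l => exact key v l

/-- Linearly independent linear forms are independent over noncommutative polynomials. -/
theorem eq_zero_of_sum_mul_eq_zero {ι : Type*} [Fintype ι] {L : ι → NCPoly α}
    (hL : ∀ i, L i ∈ homog α 1) (hli : LinearIndependent ℚ L) {f : ι → NCPoly α}
    (hf : ∑ i, f i * L i = 0) (i : ι) : f i = 0 := by
  refine ext_coeff fun w => ?_
  -- Reading the relation at the words `w * x`, with `w` fixed and `x` any letter, gives a rational
  -- relation among the forms.
  have : ∑ i, (f i).coeff w • L i = 0 := by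
    refine ext_coeff fun v => ?_
    rw [MonoidAlgebra.coeff_sum, Finsupp.finsetSum_apply]
    by_cases hv : v.length = 1
    · obtain ⟨x, rfl⟩ := FreeMonoid.length_eq_one.1 hv
      have := congrArg (fun r => r.coeff (w * FreeMonoid.of x)) hf
      simp only [MonoidAlgebra.coeff_sum, Finsupp.finsetSum_apply,
        coeff_mul_of_mem_homog_one _ (hL _)] at this
      simpa using this
    · refine Finset.sum_eq_zero fun j _ => ?_
      have : (L j).coeff v = 0 := by
        by_contra h
        exact hv (hL j v h)
      simp [this]
  exact Fintype.linearIndependent_iff.1 hli _ this i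

theorem linearIndependent_var : LinearIndependent ℚ (var : α → NCPoly α) := by
  classical
  rw [linearIndependent_iff']
  intro s g h x hx
  have := congrArg (fun r => r.coeff (FreeMonoid.of x)) h
  simpa [MonoidAlgebra.coeff_sum, Finsupp.finsetSum_apply, var_def, Finsupp.single_apply,
    FreeMonoid.of_injective.eq_iff, hx] using this

end NCPoly

/-! ### Exponential series and the Magnus embedding -/

section ExpSeries

variable {A B : Type*} [Ring A] [Algebra ℚ A] [Ring B] [Algebra ℚ B]

/-- The power series `exp (a t)` with coefficients in a noncommutative algebra. -/
noncomputable def expSeries (a : A) : A⟦X⟧ := PowerSeries.mk fun n => (n ! : ℚ)⁻¹ • a ^ n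

theorem coeff_expSeries (a : A) (n : ℕ) :
    PowerSeries.coeff n (expSeries a) = (n ! : ℚ)⁻¹ • a ^ n := PowerSeries.coeff_mk _ _

theorem expSeries_zero : expSeries (0 : A) = 1 := by
  ext n
  rw [coeff_expSeries, PowerSeries.coeff_one]
  split_ifs with h <;> simp [h]

theorem expSeries_add_of_commute {a b : A} (h : Commute a b) :
    expSeries (a + b) = expSeries a * expSeries b := by
  ext n
  rw [coeff_expSeries, PowerSeries.coeff_mul, h.add_pow', Finset.smul_sum]
  refine Finset.sum_congr rfl fun p hp => ?_
  rw [coeff_expSeries, coeff_expSeries, smul_mul_smul_comm, ← Nat.cast_smul_eq_nsmul ℚ, smul_smul]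
  congr 1
  rw [Finset.HasAntidiagonal.mem_antidiagonal] at hp
  subst hp
  rw [Nat.cast_add_choose]
  field_simp

theorem map_expSeries (f : A →ₐ[ℚ] B) (a : A) :
    PowerSeries.map (f : A →+* B) (expSeries a) = expSeries (f a) := by
  ext n
  simp [coeff_expSeries]

/-- `expSeries a` as a unit. -/
noncomputable def expUnit (a : A) : (A⟦X⟧)ˣ where
  val := expSeries a
  inv := expSeries (-a)
  val_inv := by
    rw [← expSeries_add_of_commute (Commute.neg_right (Commute.refl a)), add_neg_cancel,
      expSeries_zero]
  inv_val := by
    rw [← expSeries_add_of_commute (Commute.neg_left (Commute.refl a)), neg_add_cancel,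
      expSeries_zero]

theorem expUnit_zpow (a : A) (n : ℤ) : ((expUnit a ^ n : (A⟦X⟧)ˣ) : A⟦X⟧) = expSeries (n • a) := by
  have nat : ∀ (a : A) (n : ℕ), expSeries a ^ n = expSeries (n • a) := by
    intro a n
    induction n with
    | zero => simp [expSeries_zero]
    | succ n ih =>
      rw [pow_succ, ih, succ_nsmul, expSeries_add_of_commute ((Commute.refl a).smul_left n)]
  cases n with
  | ofNat n =>
    rw [Int.ofNat_eq_natCast, zpow_natCast, Units.val_pow_eq_pow_val, natCast_zsmul]
    exact nat a n
  | negSucc n =>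
    rw [zpow_negSucc, ← inv_pow, Units.val_pow_eq_pow_val, negSucc_zsmul, ← smul_neg]
    exact nat (-a) (n + 1)

end ExpSeries

namespace NCPoly

variable {α : Type*}

/-- The Magnus homomorphism, in its exponential form. -/
noncomputable def magnus : FreeGroup α →* (NCPoly α)⟦X⟧ :=
  (Units.coeHom _).comp (FreeGroup.lift fun x => expUnit (var x))

theorem magnus_of (x : α) : magnus (FreeGroup.of x) = expSeries (var x) := by
  simp [magnus, expUnit]

theorem magnus_inv_of (x : α) : magnus (FreeGroup.of x)⁻¹ = expSeries (-var x) := by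
  simp [magnus, expUnit]

theorem magnus_induction {P : (NCPoly α)⟦X⟧ → Prop} (one : P 1)
    (expSeries_var : ∀ x, P (expSeries (var x)))
    (expSeries_neg_var : ∀ x, P (expSeries (-var x)))
    (mul : ∀ f g, P f → P g → P (f * g)) (g : FreeGroup α) : P (magnus g) := by
  induction g using FreeGroup.induction_on with
  | C1 => rwa [map_one]
  | of x => rw [magnus_of]; exact expSeries_var x
  | inv_of x _ => rw [magnus_inv_of]; exact expSeries_neg_var x
  | mul g h hg hh => rw [map_mul]; exact mul _ _ hg hh

theorem constantCoeff_magnus (g : FreeGroup α) : PowerSeries.coeff 0 (magnus g) = 1 := by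
  refine magnus_induction (P := fun f => PowerSeries.coeff 0 f = 1) (by simp) ?_ ?_ ?_ g
  · intro x; simp [coeff_expSeries]
  · intro x; simp [coeff_expSeries]
  · intro f g hf hg
    rw [PowerSeries.coeff_mul]
    simp [hf, hg]

/-- The power series whose coefficient of index `n` is homogeneous of degree `n`. -/
noncomputable def gradedSeries (α : Type*) : Subring (NCPoly α)⟦X⟧ where
  carrier := {f | ∀ n, PowerSeries.coeff n f ∈ homog α n}
  zero_mem' n := by simp
  one_mem' n := by
    rw [PowerSeries.coeff_one]
    split_ifs with h
    · rw [h]; exact one_mem_homog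
    · exact Submodule.zero_mem _
  add_mem' hf hg n := by rw [map_add]; exact Submodule.add_mem _ (hf n) (hg n)
  neg_mem' hf n := by rw [map_neg]; exact Submodule.neg_mem _ (hf n)
  mul_mem' hf hg n := by
    rw [PowerSeries.coeff_mul]
    refine Submodule.sum_mem _ fun p hp => ?_
    rw [← Finset.HasAntidiagonal.mem_antidiagonal.1 hp]
    exact mul_mem_homog (hf _) (hg _)

theorem pow_mem_homog {r : NCPoly α} (hr : r ∈ homog α 1) (n : ℕ) : r ^ n ∈ homog α n := by
  induction n with
  | zero => rw [pow_zero]; exact one_mem_homog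
  | succ n ih => rw [pow_succ]; exact mul_mem_homog ih hr

theorem expSeries_mem_gradedSeries {r : NCPoly α} (hr : r ∈ homog α 1) :
    expSeries r ∈ gradedSeries α := fun n => by
  rw [coeff_expSeries]
  exact Submodule.smul_mem _ _ (pow_mem_homog hr n)

theorem magnus_mem_gradedSeries (g : FreeGroup α) : magnus g ∈ gradedSeries α :=
  magnus_induction (P := (· ∈ gradedSeries α)) (one_mem _)
    (fun x => expSeries_mem_gradedSeries (var_mem_homog x))
    (fun x => expSeries_mem_gradedSeries (neg_mem (var_mem_homog x)))
    (fun _ _ => mul_mem) g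

/-- Group elements are group-like. The exponential of a primitive element is, since `r ⊗ 1` and `1 ⊗
r` commute; products inherit it because the left and right copies commute. -/
theorem map_comul_magnus (g : FreeGroup α) :
    PowerSeries.map (comul : NCPoly α →ₐ[ℚ] _).toRingHom (magnus g) =
      PowerSeries.map (Algebra.TensorProduct.includeLeft :
        NCPoly α →ₐ[ℚ] NCPoly α ⊗[ℚ] NCPoly α).toRingHom (magnus g) *
      PowerSeries.map (Algebra.TensorProduct.includeRight :
        NCPoly α →ₐ[ℚ] NCPoly α ⊗[ℚ] NCPoly α).toRingHom (magnus g) := by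
  have exp_case : ∀ r : NCPoly α, comul r = r ⊗ₜ[ℚ] 1 + 1 ⊗ₜ[ℚ] r →
      PowerSeries.map (comul : NCPoly α →ₐ[ℚ] _).toRingHom (expSeries r) =
      PowerSeries.map (Algebra.TensorProduct.includeLeft :
        NCPoly α →ₐ[ℚ] NCPoly α ⊗[ℚ] NCPoly α).toRingHom (expSeries r) *
      PowerSeries.map (Algebra.TensorProduct.includeRight :
        NCPoly α →ₐ[ℚ] NCPoly α ⊗[ℚ] NCPoly α).toRingHom (expSeries r) := by
    intro r hr
    have h1 := map_expSeries (comul : NCPoly α →ₐ[ℚ] _) r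
    have h2 := map_expSeries (Algebra.TensorProduct.includeLeft :
        NCPoly α →ₐ[ℚ] NCPoly α ⊗[ℚ] NCPoly α) r
    have h3 := map_expSeries (Algebra.TensorProduct.includeRight :
        NCPoly α →ₐ[ℚ] NCPoly α ⊗[ℚ] NCPoly α) r
    refine h1.trans (Eq.trans ?_ (congrArg₂ (· * ·) h2 h3).symm)
    rw [hr]
    exact expSeries_add_of_commute (by simp [Commute, SemiconjBy])
  refine magnus_induction (P := fun f => PowerSeries.map (comul : NCPoly α →ₐ[ℚ] _).toRingHom f =
      PowerSeries.map (Algebra.TensorProduct.includeLeft :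
        NCPoly α →ₐ[ℚ] NCPoly α ⊗[ℚ] NCPoly α).toRingHom f *
      PowerSeries.map (Algebra.TensorProduct.includeRight :
        NCPoly α →ₐ[ℚ] NCPoly α ⊗[ℚ] NCPoly α).toRingHom f) ?_ ?_ ?_ ?_ g
  · simp only [map_one, mul_one]
  · intro x
    exact exp_case _ (comul_var x)
  · intro x
    exact exp_case _ (by rw [map_neg, comul_var, TensorProduct.neg_tmul, TensorProduct.tmul_neg]; abel)
  · intro f g hf hg
    have comm : ∀ f g : (NCPoly α)⟦X⟧, Commute
        (PowerSeries.map (Algebra.TensorProduct.includeLeft :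
          NCPoly α →ₐ[ℚ] NCPoly α ⊗[ℚ] NCPoly α).toRingHom f)
        (PowerSeries.map (Algebra.TensorProduct.includeRight :
          NCPoly α →ₐ[ℚ] NCPoly α ⊗[ℚ] NCPoly α).toRingHom g) := by
      intro f g
      ext n
      rw [PowerSeries.coeff_mul, PowerSeries.coeff_mul, ← Finset.Nat.sum_antidiagonal_swap]
      refine Finset.sum_congr rfl fun p _ => ?_
      simp
    rw [map_mul, map_mul, map_mul, hf, hg, mul_assoc, mul_assoc, ← mul_assoc _ _ (PowerSeries.map _ g),
      ← (comm g f).eq, mul_assoc]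

/-- The lowest term of a non-trivial element in the Magnus embedding is primitive. -/
theorem comul_coeff_magnus {g : FreeGroup α} {m : ℕ} (hm : 0 < m)
    (h : ∀ k, 0 < k → k < m → PowerSeries.coeff k (magnus g) = 0) :
    comul (PowerSeries.coeff m (magnus g)) =
      PowerSeries.coeff m (magnus g) ⊗ₜ[ℚ] 1 + 1 ⊗ₜ[ℚ] PowerSeries.coeff m (magnus g) := by
  have key := congrArg (PowerSeries.coeff m) (map_comul_magnus g)
  rw [PowerSeries.coeff_map, PowerSeries.coeff_mul] at key
  refine key.trans ?_
  -- Coefficients strictly between `0` and `m` vanish, and the constant term is `1`.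
  rw [Finset.sum_eq_add (m, 0) (0, m) (by simp [hm.ne'])]
  · simp [-PowerSeries.coeff_zero_eq_constantCoeff, constantCoeff_magnus]
  · rintro ⟨i, j⟩ hij ⟨h1, h2⟩
    rw [Finset.HasAntidiagonal.mem_antidiagonal] at hij
    simp only [ne_eq, Prod.mk.injEq, not_and] at h1 h2 hij
    have : PowerSeries.coeff i (magnus g) = 0 := h i (by omega) (by omega)
    simp [this]
  · simp
  · simp

/-! ### Injectivity of the Magnus homomorphism -/

/-- The coefficient of the word `w` in a series, in the degree given by the length of `w`. -/
noncomputable def wordCoeff (w : FreeMonoid α) (f : (NCPoly α)⟦X⟧) : ℚ :=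
  (PowerSeries.coeff w.length f).coeff w

theorem smul_var_pow (n : ℤ) (i : α) (p : ℕ) :
    (n • var i) ^ p = MonoidAlgebra.single (FreeMonoid.of i ^ p) ((n : ℚ) ^ p) := by
  rw [var_def, ← Int.cast_smul_eq_zsmul ℚ, MonoidAlgebra.smul_single, MonoidAlgebra.single_pow]
  simp

theorem coeff_expSeries_smul_var_mul (n : ℤ) (i : α) (f : (NCPoly α)⟦X⟧) (w : FreeMonoid α) :
    wordCoeff w (expSeries (n • var i) * f) =
      ∑ p ∈ Finset.HasAntidiagonal.antidiagonal w.length, (MonoidAlgebra.single (FreeMonoid.of i ^ p.1)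
        ((p.1 ! : ℚ)⁻¹ * (n : ℚ) ^ p.1) * PowerSeries.coeff p.2 f).coeff w := by
  rw [wordCoeff, PowerSeries.coeff_mul, MonoidAlgebra.coeff_sum, Finsupp.finsetSum_apply]
  refine Finset.sum_congr rfl fun p _ => ?_
  rw [coeff_expSeries, smul_var_pow, MonoidAlgebra.smul_single, smul_eq_mul]

theorem wordCoeff_expSeries_mul_of_ne {n : ℤ} {i : α} {w : FreeMonoid α}
    (hw : ∀ d, FreeMonoid.of i * d ≠ w) (f : (NCPoly α)⟦X⟧) :
    wordCoeff w (expSeries (n • var i) * f) = wordCoeff w f := by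
  rw [coeff_expSeries_smul_var_mul, Finset.sum_eq_single (0, w.length)]
  · simp [wordCoeff, ← MonoidAlgebra.one_def]
  · rintro ⟨p, q⟩ hpq hne
    rw [Finset.HasAntidiagonal.mem_antidiagonal] at hpq
    rcases p with _ | p
    · exact absurd (by simp_all) hne
    · refine MonoidAlgebra.coeff_single_mul_of_forall_mul_ne _ _ fun d hd => ?_
      rw [pow_succ', mul_assoc] at hd
      exact hw _ hd
  · simp

/-- As `w` does not begin with `i`, only the constant and linear terms of the exponential can
contribute. -/
theorem wordCoeff_of_mul_expSeries_mul {n : ℤ} {i : α} {w : FreeMonoid α}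
    (hw : ∀ d, FreeMonoid.of i * d ≠ w) (f : (NCPoly α)⟦X⟧) :
    wordCoeff (FreeMonoid.of i * w) (expSeries (n • var i) * f) =
      wordCoeff (FreeMonoid.of i * w) f + n * wordCoeff w f := by
  rw [coeff_expSeries_smul_var_mul, Finset.sum_eq_add (0, w.length + 1) (1, w.length) (by simp)]
  · congr 1
    · simp [wordCoeff, add_comm, ← MonoidAlgebra.one_def]
    · simp only [pow_one, Nat.factorial_one, Nat.cast_one, inv_one, one_mul]
      rw [MonoidAlgebra.coeff_single_mul_eq_mul_coeff (m₂ := w) (fun m' _ => mul_right_inj _)]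
      rfl
  · rintro ⟨p, q⟩ hpq ⟨h0, h1⟩
    rw [Finset.HasAntidiagonal.mem_antidiagonal] at hpq
    simp only [FreeMonoid.length_mul, FreeMonoid.length_of] at hpq
    rcases p with _ | _ | p
    · exact absurd (by simp; omega) h0
    · exact absurd (by simp; omega) h1
    · refine MonoidAlgebra.coeff_single_mul_of_forall_mul_ne _ _ fun d hd => ?_
      rw [pow_succ', mul_assoc] at hd
      have := mul_left_cancel hd
      rw [pow_succ', mul_assoc] at this
      exact hw _ this
  · intro h; exact absurd (by simp [add_comm]) h
  · intro h; exact absurd (by simp [add_comm]) h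

theorem wordCoeff_one {w : FreeMonoid α} (hw : w ≠ 1) : wordCoeff w 1 = 0 := by
  rw [wordCoeff, PowerSeries.coeff_one, if_neg fun h => hw (FreeMonoid.length_eq_zero.1 h)]
  rfl

theorem of_mul_ne_of_isChain {i : α} {w : List α} (h : (i :: w).IsChain (· ≠ ·)) (d : FreeMonoid α) :
    FreeMonoid.of i * d ≠ FreeMonoid.ofList w := by
  rintro rfl
  exact (List.isChain_cons_cons.1 (show (i :: i :: FreeMonoid.toList d).IsChain (· ≠ ·) from h)).1 rfl

/-- A product of syllables has vanishing coefficients at the longer alternating words, and a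
non-zero coefficient at its own word. -/
theorem wordCoeff_prod_syllables (l : List (α × ℤ)) (hl : ∀ p ∈ l, p.2 ≠ 0)
    (hchain : (l.map Prod.fst).IsChain (· ≠ ·)) :
    (∀ w : List α, w.IsChain (· ≠ ·) → l.length < w.length →
      wordCoeff (FreeMonoid.ofList w) (l.map fun p => expSeries (p.2 • var p.1)).prod = 0) ∧
    wordCoeff (FreeMonoid.ofList (l.map Prod.fst))
      (l.map fun p => expSeries (p.2 • var p.1)).prod ≠ 0 := by
  induction l with
  | nil =>
    refine ⟨fun w _ hw => wordCoeff_one fun h => ?_, ?_⟩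
    · rw [show w = [] from h] at hw
      exact absurd hw (by simp)
    · simp [wordCoeff]
  | cons p l ih =>
    obtain ⟨ih1, ih2⟩ := ih (fun q hq => hl q (List.mem_cons_of_mem _ hq))
      (by rw [List.map_cons] at hchain; exact hchain.tail)
    simp only [List.map_cons, List.prod_cons]
    constructor
    · intro w hw hlen
      rcases w with _ | ⟨v, w⟩
      · exact absurd hlen (by simp)
      · simp only [List.length_cons] at hlen
        by_cases hv : p.1 = v
        · subst hv
          have := wordCoeff_of_mul_expSeries_mul (n := p.2) (of_mul_ne_of_isChain hw)
            (l.map fun p => expSeries (p.2 • var p.1)).prod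
          rw [← FreeMonoid.ofList_cons] at this
          rw [this, ih1 w hw.tail (by omega), ih1 _ hw (by simp; omega), mul_zero, add_zero]
        · rw [wordCoeff_expSeries_mul_of_ne]
          · exact ih1 _ hw (by simp; omega)
          · intro d hd
            exact hv (List.cons.inj (show p.1 :: FreeMonoid.toList d = v :: w from hd)).1
    · have := wordCoeff_of_mul_expSeries_mul (n := p.2)
        (of_mul_ne_of_isChain (by simpa using hchain))
        (l.map fun p => expSeries (p.2 • var p.1)).prod
      rw [← FreeMonoid.ofList_cons] at this
      -- The full word is too long for the tail of the product, leaving the exponent times the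
      -- tail's own coefficient.
      rw [this, ih1 _ (by simpa using hchain) (by simp), zero_add]
      exact mul_ne_zero (by exact_mod_cast hl p (by simp)) ih2

/-- The free group is a free product of infinite cyclic groups; the syllables come from the reduced
word there. -/
theorem exists_syllables {g : FreeGroup α} (hg : g ≠ 1) : ∃ l : List (α × ℤ), l ≠ [] ∧
    (∀ p ∈ l, p.2 ≠ 0) ∧ (l.map Prod.fst).IsChain (· ≠ ·) ∧
    magnus g = (l.map fun p => expSeries (p.2 • var p.1)).prod := by
  classical
  let e : FreeGroup Unit ≃ ℤ := FreeGroup.freeGroupUnitEquivInt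
  have he : ∀ m : FreeGroup Unit, m = FreeGroup.of () ^ e m := fun m => (e.symm_apply_apply m).symm
  let w := Monoid.CoprodI.Word.equiv (freeGroupEquivCoprodI g)
  have hw : freeGroupEquivCoprodI.symm w.prod = g := by
    rw [MulEquiv.symm_apply_eq]
    exact Monoid.CoprodI.Word.equiv.symm_apply_apply (freeGroupEquivCoprodI g)
  refine ⟨w.toList.map fun s => (s.1, e s.2), ?_, ?_, ?_, ?_⟩
  · intro h
    rw [List.map_eq_nil_iff] at h
    refine hg ?_
    rw [← hw, Monoid.CoprodI.Word.prod, h]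
    simp
  · intro p hp h
    obtain ⟨s, hs, rfl⟩ := List.mem_map.1 hp
    refine w.ne_one s hs ?_
    rw [he s.2, show e s.2 = 0 from h, zpow_zero]
  · rw [List.map_map, List.isChain_map]
    exact w.chain_ne
  · rw [← hw, Monoid.CoprodI.Word.prod, map_list_prod, map_list_prod, List.map_map, List.map_map,
      List.map_map]
    congr 1
    refine List.map_congr_left fun s _ => ?_
    simp only [Function.comp_apply]
    rw [← expUnit_zpow, freeGroupEquivCoprodI_symm_apply, Monoid.CoprodI.lift_of]
    conv_lhs => rw [he s.2]
    simp [magnus]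

theorem magnus_ne_one {g : FreeGroup α} (hg : g ≠ 1) : magnus g ≠ 1 := by
  obtain ⟨l, hne, h0, hchain, h⟩ := exists_syllables hg
  intro h1
  refine (wordCoeff_prod_syllables l h0 hchain).2 ?_
  rw [← h, h1]
  refine wordCoeff_one fun h => hne ?_
  exact List.map_eq_nil_iff.1 h

/-! ### Linear relations between series -/

/-- Series without constant term whose linear terms are linearly independent are independent over
the ring of all series. -/
theorem eq_zero_of_sum_mul_series_eq_zero {ι : Type*} [Fintype ι] {y : ι → (NCPoly α)⟦X⟧}
    (hy0 : ∀ i, PowerSeries.coeff 0 (y i) = 0) (hy1 : ∀ i, PowerSeries.coeff 1 (y i) ∈ homog α 1)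
    (hli : LinearIndependent ℚ fun i => PowerSeries.coeff 1 (y i)) {f : ι → (NCPoly α)⟦X⟧}
    (hf : ∑ i, f i * y i = 0) (i : ι) : f i = 0 := by
  suffices h : ∀ n i, PowerSeries.coeff n (f i) = 0 from PowerSeries.ext fun n => h n i
  intro n
  induction n using Nat.strong_induction_on with
  | _ n ih =>
    refine eq_zero_of_sum_mul_eq_zero hy1 hli ?_
    -- Once the lower coefficients of all `f i` vanish, degree `n + 1` retains only the degree-`n`
    -- terms times the linear terms.
    have := congrArg (PowerSeries.coeff (n + 1)) hf
    rw [map_sum, map_zero] at this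
    rw [← this]
    refine Finset.sum_congr rfl fun i _ => ?_
    rw [PowerSeries.coeff_mul, Finset.sum_eq_single (n, 1)]
    · rintro ⟨p, q⟩ hpq hne
      rw [Finset.HasAntidiagonal.mem_antidiagonal] at hpq
      simp only at hpq
      rcases q with _ | q
      · rw [hy0, mul_zero]
      · rcases q with _ | q
        · exact absurd (by simp; omega) hne
        · rw [ih p (by omega), zero_mul]
    · intro h; exact absurd (by simp) h

/-! ### Relations among the series `g - 1` -/

/-- The deviation from `1` of a group element in the Magnus embedding. -/
noncomputable def aug (g : FreeGroup α) : (NCPoly α)⟦X⟧ := magnus g - 1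

theorem aug_mem_gradedSeries (g : FreeGroup α) : aug g ∈ gradedSeries α :=
  sub_mem (magnus_mem_gradedSeries g) (one_mem _)

theorem coeff_zero_aug (g : FreeGroup α) : PowerSeries.coeff 0 (aug g) = 0 := by
  rw [aug, map_sub, constantCoeff_magnus]; simp

theorem coeff_aug_of_ne_zero (g : FreeGroup α) {n : ℕ} (hn : n ≠ 0) :
    PowerSeries.coeff n (aug g) = PowerSeries.coeff n (magnus g) := by
  rw [aug, map_sub, PowerSeries.coeff_one, if_neg hn, sub_zero]

theorem coeff_one_aug_of (x : α) : PowerSeries.coeff 1 (aug (FreeGroup.of x)) = var x := by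
  rw [coeff_aug_of_ne_zero _ one_ne_zero, magnus_of, coeff_expSeries]
  simp

theorem coeff_one_mul_aug (f : (NCPoly α)⟦X⟧) (g : FreeGroup α) :
    PowerSeries.coeff 1 (f * aug g) = PowerSeries.coeff 0 f * PowerSeries.coeff 1 (aug g) := by
  rw [PowerSeries.coeff_mul, Finset.Nat.sum_antidiagonal_eq_sum_range_succ
    (fun i j => PowerSeries.coeff i f * PowerSeries.coeff j (aug g)), Finset.sum_range_succ,
    Finset.sum_range_one, Nat.sub_self, coeff_zero_aug, mul_zero, add_zero]

/-- This rests on `gh - 1 = g(h - 1) + (g - 1)` and `g⁻¹ - 1 = -g⁻¹(g - 1)`. Coefficients are kept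
in `gradedSeries` so that their constant terms are rational numbers. -/
theorem aug_mem_span_of_mem_closure {S : Set (FreeGroup α)} {g : FreeGroup α}
    (hg : g ∈ Subgroup.closure S) : aug g ∈ Submodule.span (gradedSeries α) (aug '' S) := by
  induction hg using Subgroup.closure_induction with
  | mem g hg => exact Submodule.subset_span ⟨g, hg, rfl⟩
  | one => simp [aug]
  | mul g h _ _ hg hh =>
    have : aug (g * h) = (⟨magnus g, magnus_mem_gradedSeries g⟩ : gradedSeries α) • aug h + aug g := by
      rw [Subring.smul_def, smul_eq_mul, aug, aug, aug, map_mul]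
      noncomm_ring
    rw [this]
    exact Submodule.add_mem _ (Submodule.smul_mem _ _ hh) hg
  | inv g _ hg =>
    have : aug g⁻¹ =
        -((⟨magnus g⁻¹, magnus_mem_gradedSeries g⁻¹⟩ : gradedSeries α) • aug g) := by
      rw [Subring.smul_def, smul_eq_mul, aug, aug, mul_sub, ← map_mul, inv_mul_cancel, map_one]
      noncomm_ring
    rw [this]
    exact Submodule.neg_mem _ (Submodule.smul_mem _ _ hg)

theorem exists_coeff_zero_eq_smul (f : gradedSeries α) :
    ∃ l : ℚ, PowerSeries.coeff 0 (f : (NCPoly α)⟦X⟧) = l • 1 :=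
  ⟨_, eq_smul_one_of_mem_homog_zero (f.2 0)⟩

theorem exists_aug_eq_sum {ι : Type*} [Fintype ι] {g : ι → FreeGroup α}
    (hg : Subgroup.closure (Set.range g) = ⊤) (h : FreeGroup α) :
    ∃ c : ι → gradedSeries α, ∑ j, (c j : (NCPoly α)⟦X⟧) * aug (g j) = aug h := by
  have := aug_mem_span_of_mem_closure (g := h) (S := Set.range g) (by rw [hg]; trivial)
  rw [← Set.range_comp, Submodule.mem_span_range_iff_exists_fun] at this
  exact this

/-- The constant series with a rational value. -/
noncomputable def constSeries (l : ℚ) : gradedSeries α :=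
  ⟨PowerSeries.C (l • 1), fun n => by
    rw [PowerSeries.coeff_C]
    split_ifs with h
    · rw [h]; exact Submodule.smul_mem _ _ one_mem_homog
    · exact Submodule.zero_mem _⟩

theorem coeff_zero_constSeries (l : ℚ) :
    PowerSeries.coeff 0 (constSeries (α := α) l : (NCPoly α)⟦X⟧) = l • 1 := by
  rw [constSeries, PowerSeries.coeff_C, if_pos rfl]

/-- Generators with dependent linear terms satisfy a relation with a prescribed constant term. -/
theorem exists_relation {ι : Type*} [Fintype ι] {g : ι → FreeGroup α}
    (hg : Subgroup.closure (Set.range g) = ⊤) {l : ι → ℚ}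
    (hl : ∑ j, l j • PowerSeries.coeff 1 (aug (g j)) = 0) :
    ∃ K : ι → gradedSeries α, ∑ j, (K j : (NCPoly α)⟦X⟧) * aug (g j) = 0 ∧
      ∀ j, PowerSeries.coeff 0 (K j : (NCPoly α)⟦X⟧) = l j • 1 := by
  classical
  have hy : ∑ j, constSeries (α := α) (l j) • aug (g j) ∈
      Submodule.span (gradedSeries α) (Set.range fun x => aug (FreeGroup.of x)) := by
    refine Submodule.sum_mem _ fun j _ => Submodule.smul_mem _ _ ?_
    have := aug_mem_span_of_mem_closure (g := g j) (S := Set.range FreeGroup.of)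
      (by rw [FreeGroup.closure_range_of]; trivial)
    rwa [← Set.range_comp] at this
  rw [Finsupp.mem_span_range_iff_exists_finsupp] at hy
  obtain ⟨h, hh⟩ := hy
  choose c hc using fun x => exists_aug_eq_sum hg (FreeGroup.of x)
  -- The combination with constants `l j` has no linear term, and the variables are independent.
  have h0 : ∀ x, PowerSeries.coeff 0 (h x : (NCPoly α)⟦X⟧) = 0 := by
    choose a ha using fun x => exists_coeff_zero_eq_smul (h x)
    have h1 := congrArg (PowerSeries.coeff 1) hh
    rw [map_sum, Finsupp.sum, map_sum] at h1
    simp only [Subring.smul_def, smul_eq_mul, coeff_one_mul_aug, coeff_zero_constSeries,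
      smul_mul_assoc, one_mul, hl, ha, coeff_one_aug_of] at h1
    intro x
    by_cases hx : x ∈ h.support
    · rw [ha, linearIndependent_iff'.1 linearIndependent_var _ _ h1 x hx, zero_smul]
    · rw [Finsupp.notMem_support_iff.1 hx]; simp
  -- Rewriting the basis expansion through the generators and subtracting gives a relation; the
  -- corrections have no constant term.
  refine ⟨fun j => constSeries (l j) - h.sum fun x b => b * c x j, ?_, fun j => ?_⟩
  · have : ∑ j, ((h.sum fun x b => b * c x j : gradedSeries α) : (NCPoly α)⟦X⟧) * aug (g j) =
        h.sum fun x b => b • aug (FreeGroup.of x) := by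
      simp only [Finsupp.sum, AddSubmonoidClass.coe_finsetSum, Finset.sum_mul]
      rw [Finset.sum_comm]
      refine Finset.sum_congr rfl fun x _ => ?_
      rw [Subring.smul_def, smul_eq_mul, ← hc x, Finset.mul_sum]
      refine Finset.sum_congr rfl fun j _ => ?_
      rw [Subring.coe_mul, mul_assoc]
    simp only [AddSubgroupClass.coe_sub, sub_mul, Finset.sum_sub_distrib]
    rw [this, hh, sub_eq_zero]
    rfl
  · rw [AddSubgroupClass.coe_sub, map_sub, coeff_zero_constSeries, Finsupp.sum,
      AddSubmonoidClass.coe_finsetSum, map_sum, Finset.sum_eq_zero, sub_zero]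
    intro x _
    rw [Subring.coe_mul, PowerSeries.coeff_mul]
    simp [-PowerSeries.coeff_zero_eq_constantCoeff, h0]

/-- In a free group of rank at least three generated by four elements, removing a generator whose
linear term depends on the others leaves generators with independent linear terms. -/
theorem linearIndependent_of_relation {g : Fin 4 → FreeGroup α}
    (hg : Subgroup.closure (Set.range g) = ⊤) {e : Fin 3 → α} (he : Function.Injective e)
    {l : Fin 4 → ℚ} (hl : ∑ j, l j • PowerSeries.coeff 1 (aug (g j)) = 0) {i : Fin 4}
    (hi : l i ≠ 0) :
    LinearIndependent ℚ fun j : {j // j ≠ i} => PowerSeries.coeff 1 (aug (g j)) := by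
  classical
  set b := fun j : {j // j ≠ i} => PowerSeries.coeff 1 (aug (g j)) with hb
  have hmem : ∀ j, PowerSeries.coeff 1 (aug (g j)) ∈ Submodule.span ℚ (Set.range b) := by
    intro j
    by_cases hj : j = i
    · subst hj
      rw [← Finset.add_sum_erase _ _ (Finset.mem_univ j)] at hl
      have : PowerSeries.coeff 1 (aug (g j)) = (l j)⁻¹ • -∑ k ∈ Finset.univ.erase j,
          l k • PowerSeries.coeff 1 (aug (g k)) := by
        rw [← eq_neg_of_add_eq_zero_left hl, smul_smul, inv_mul_cancel₀ hi, one_smul]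
      rw [this]
      refine Submodule.smul_mem _ _ (Submodule.neg_mem _ (Submodule.sum_mem _ fun k hk => ?_))
      exact Submodule.smul_mem _ _ (Submodule.subset_span ⟨⟨k, Finset.ne_of_mem_erase hk⟩, rfl⟩)
    · exact Submodule.subset_span ⟨⟨j, hj⟩, rfl⟩
  -- Three independent variables in the span of three vectors force these vectors to be independent.
  have hvar : ∀ x, var x ∈ Submodule.span ℚ (Set.range b) := by
    intro x
    obtain ⟨c, hc⟩ := exists_aug_eq_sum hg (FreeGroup.of x)
    rw [← coeff_one_aug_of, ← hc, map_sum]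
    refine Submodule.sum_mem _ fun j _ => ?_
    obtain ⟨a, ha⟩ := exists_coeff_zero_eq_smul (c j)
    rw [coeff_one_mul_aug, ha, smul_mul_assoc, one_mul]
    exact Submodule.smul_mem _ _ (hmem j)
  rw [linearIndependent_iff_card_le_finrank_span]
  have hind : LinearIndependent ℚ fun k : Fin 3 =>
      (⟨var (e k), hvar (e k)⟩ : Submodule.span ℚ (Set.range b)) :=
    LinearIndependent.of_comp (Submodule.subtype _) (linearIndependent_var.comp e he)
  have : Module.Finite ℚ (Submodule.span ℚ (Set.range b)) :=
    Module.Finite.span_of_finite ℚ (Set.finite_range b)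
  have h3 := hind.fintype_card_le_finrank
  rw [Fintype.card_fin] at h3
  rw [Fintype.card_subtype_compl, Fintype.card_fin, Fintype.card_subtype_eq]
  exact h3

/-- If a free group of rank at least three is generated by `a, b, c, d`, then the elements of
`⟨a, b⟩ ∩ ⟨c, d⟩` have a common right divisor without constant term in the Magnus embedding. -/
theorem exists_common_right_divisor {g : Fin 4 → FreeGroup α}
    (hg : Subgroup.closure (Set.range g) = ⊤) {e : Fin 3 → α} (he : Function.Injective e) :
    ∃ z ∈ gradedSeries α, PowerSeries.coeff 0 z = 0 ∧
      ∀ u ∈ Subgroup.closure {g 0, g 1}, u ∈ Subgroup.closure {g 2, g 3} →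
        ∃ q, aug u = q * z := by
  have expr : ∀ {u i j}, u ∈ Subgroup.closure {g i, g j} →
      ∃ s t : gradedSeries α, aug u = s * aug (g i) + t * aug (g j) := by
    intro u i j hu
    have := aug_mem_span_of_mem_closure hu
    rw [Set.image_pair, Submodule.mem_span_pair] at this
    obtain ⟨s, t, h⟩ := this
    exact ⟨s, t, h.symm⟩
  have rel : ∀ u ∈ Subgroup.closure {g 0, g 1}, u ∈ Subgroup.closure {g 2, g 3} →
      ∃ K : Fin 4 → (NCPoly α)⟦X⟧, ∑ j, K j * aug (g j) = 0 ∧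
        aug u = K 0 * aug (g 0) + K 1 * aug (g 1) := by
    intro u hu hu'
    obtain ⟨s, t, h⟩ := expr hu
    obtain ⟨s', t', h'⟩ := expr hu'
    refine ⟨![s, t, -s', -t'], ?_, h⟩
    rw [Fin.sum_univ_four]
    simp only [Matrix.cons_val]
    rw [← h, neg_mul, add_assoc, neg_mul, ← neg_add, ← h', add_neg_cancel]
  -- With independent linear terms there are no relations at all, so `aug u = 0` and `z = 0` serves.
  by_cases hli : LinearIndependent ℚ fun j => PowerSeries.coeff 1 (aug (g j))
  · refine ⟨0, zero_mem _, map_zero _, fun u hu hu' => ⟨0, ?_⟩⟩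
    obtain ⟨K, hK, h⟩ := rel u hu hu'
    have := eq_zero_of_sum_mul_series_eq_zero (fun j => coeff_zero_aug (g j))
      (fun j => aug_mem_gradedSeries (g j) 1) hli hK
    rw [h, this, this]; simp
  · obtain ⟨l, hl, i, hi⟩ := Fintype.not_linearIndependent_iff.1 hli
    obtain ⟨K, hK, hK0⟩ := exists_relation hg hl
    refine ⟨K 0 * aug (g 0) + K 1 * aug (g 1), add_mem (mul_mem (K 0).2 (aug_mem_gradedSeries _))
      (mul_mem (K 1).2 (aug_mem_gradedSeries _)), ?_, fun u hu hu' => ?_⟩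
    · simp [-PowerSeries.coeff_zero_eq_constantCoeff, PowerSeries.coeff_mul, coeff_zero_aug]
    · obtain ⟨K', hK', h⟩ := rel u hu hu'
      let c : (NCPoly α)ˣ := ⟨l i • 1, (l i)⁻¹ • 1, by simp [smul_smul, hi], by simp [smul_smul, hi]⟩
      let q := K' i * PowerSeries.invOfUnit (K i : (NCPoly α)⟦X⟧) c
      have hq : ∀ j, K' j = q * K j := by
        have hqi : K' i - q * K i = 0 := by
          rw [mul_assoc, PowerSeries.invOfUnit_mul _ _
            (by rw [← PowerSeries.coeff_zero_eq_constantCoeff_apply]; exact hK0 i), mul_one, sub_self]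
        have hsum : ∑ j, (K' j - q * K j) * aug (g j) = 0 := by
          simp only [sub_mul, Finset.sum_sub_distrib, mul_assoc]
          rw [hK', ← Finset.mul_sum, hK]; simp
        have hsum' : ∑ j : {j // j ≠ i}, (K' j - q * K j) * aug (g j) = 0 := by
          rwa [Fintype.sum_eq_add_sum_subtype_ne _ i, hqi, zero_mul, zero_add] at hsum
        intro j
        by_cases hj : j = i
        · rw [hj]; exact sub_eq_zero.1 hqi
        · exact sub_eq_zero.1 (eq_zero_of_sum_mul_series_eq_zero
            (fun j : {j // j ≠ i} => coeff_zero_aug (g j))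
            (fun j => aug_mem_gradedSeries (g j) 1) (linearIndependent_of_relation hg he hl hi)
            hsum' ⟨j, hj⟩)
      exact ⟨q, by rw [h, hq 0, hq 1, mul_add, mul_assoc q, mul_assoc q]⟩

/-- All multiples of a homogeneous series that come from non-trivial group elements have the
same order. -/
theorem order_aug_eq {z q : (NCPoly α)⟦X⟧} (hz : z ∈ gradedSeries α)
    (hz0 : PowerSeries.coeff 0 z = 0) {u : FreeGroup α} (hu : u ≠ 1) (h : aug u = q * z) :
    (aug u).order = z.order := by
  have hu0 : aug u ≠ 0 := fun h => magnus_ne_one hu (sub_eq_zero.1 h)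
  have hq0 : q ≠ 0 := fun h' => hu0 (by rw [h, h', zero_mul])
  have hz0' : z ≠ 0 := fun h' => hu0 (by rw [h, h', mul_zero])
  set a := q.order.toNat
  set d := z.order.toNat
  have hz1 := PowerSeries.coeff_order hz0'
  have hd : d ≠ 0 := by
    intro h
    rw [show z.order.toNat = 0 from h] at hz1
    exact hz1 hz0
  have horder : (aug u).order = ((a + d : ℕ) : ℕ∞) := by
    rw [h, PowerSeries.order_mul]
    push_cast
    rw [ENat.natCast_toNat (PowerSeries.order_finite_iff_ne_zero.2 hq0 |>.ne),
      ENat.natCast_toNat (PowerSeries.order_finite_iff_ne_zero.2 hz0' |>.ne)]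
  have hcoeff : PowerSeries.coeff (a + d) (magnus u) =
      PowerSeries.coeff a q * PowerSeries.coeff d z := by
    rw [← coeff_aug_of_ne_zero u (by omega), h, PowerSeries.coeff_mul, Finset.sum_eq_single (a, d)]
    · rintro ⟨i, j⟩ hij hne
      rw [Finset.HasAntidiagonal.mem_antidiagonal] at hij
      simp only at hij
      rcases lt_or_ge i a with hi | hi
      · rw [PowerSeries.coeff_of_lt_order_toNat i hi, zero_mul]
      · rcases lt_or_ge j d with hj | hj
        · rw [PowerSeries.coeff_of_lt_order_toNat j hj, mul_zero]
        · exact absurd (by simp; omega) hne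
    · intro h; exact absurd (by simp) h
  have hprim := comul_coeff_magnus (g := u) (m := a + d) (by omega) (by
    intro k hk hk'
    rw [← coeff_aug_of_ne_zero u hk.ne']
    exact PowerSeries.coeff_of_lt_order k (by rw [horder]; exact_mod_cast hk'))
  rw [hcoeff] at hprim
  -- The lowest term of `z` has degree `d > 0`, so irreducibility makes the lowest term of `q` a
  -- constant.
  have had : a + d = d := by
    rcases mem_homog_zero_or_of_primitive_mul hprim with hq | hz'
    · have h1 := mul_mem_homog hq (hz d)
      rw [zero_add] at h1
      have h2 := magnus_mem_gradedSeries u (a + d)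
      rw [hcoeff] at h2
      exact eq_of_mem_homog h2 h1 (mul_ne_zero (PowerSeries.coeff_order hq0) hz1)
    · exact absurd (eq_of_mem_homog (hz d) hz' hz1) hd
  rw [horder, had, ENat.natCast_toNat (PowerSeries.order_finite_iff_ne_zero.2 hz0' |>.ne)]

theorem commute_of_mem_closure_pairs {g : Fin 4 → FreeGroup α}
    (hg : Subgroup.closure (Set.range g) = ⊤) {e : Fin 3 → α} (he : Function.Injective e)
    {u v : FreeGroup α} (hu : u ∈ Subgroup.closure {g 0, g 1})
    (hu' : u ∈ Subgroup.closure {g 2, g 3}) (hv : v ∈ Subgroup.closure {g 0, g 1})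
    (hv' : v ∈ Subgroup.closure {g 2, g 3}) : u * v = v * u := by
  obtain ⟨z, hz, hz0, hdiv⟩ := exists_common_right_divisor hg he
  have horder : ∀ w ∈ Subgroup.closure {g 0, g 1}, w ∈ Subgroup.closure {g 2, g 3} → w ≠ 1 →
      (aug w).order = z.order := fun w hw hw' hne => by
    obtain ⟨q, hq⟩ := hdiv w hw hw'
    exact order_aug_eq hz hz0 hne hq
  by_contra hne
  have hu1 : u ≠ 1 := by rintro rfl; simp at hne
  have hv1 : v ≠ 1 := by rintro rfl; simp at hne
  have hw := horder (u * v * (v * u)⁻¹)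
    (mul_mem (mul_mem hu hv) (inv_mem (mul_mem hv hu)))
    (mul_mem (mul_mem hu' hv') (inv_mem (mul_mem hv' hu')))
    (fun h => hne (mul_inv_eq_one.1 h))
  have haug : aug (u * v * (v * u)⁻¹) =
      (aug u * aug v - aug v * aug u) * magnus (v * u)⁻¹ := by
    have h1 : magnus (v * u) * magnus (v * u)⁻¹ = 1 := by rw [← map_mul, mul_inv_cancel, map_one]
    have h2 : aug u * aug v - aug v * aug u = magnus (u * v) - magnus (v * u) := by
      rw [map_mul, map_mul, aug, aug]; noncomm_ring
    rw [h2, sub_mul, h1, ← map_mul, aug]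
  have hu0 : aug u ≠ 0 := fun h => magnus_ne_one hu1 (sub_eq_zero.1 h)
  -- The commutator lies in the intersection, so it has the order of `z`; yet both products in
  -- `haug` have twice that order.
  have hle : z.order + z.order ≤ z.order := by
    refine le_trans ?_ (haug ▸ hw).le
    refine le_trans ?_ (PowerSeries.le_order_mul _ _)
    refine le_trans ?_ le_self_add
    rw [sub_eq_add_neg]
    refine le_trans ?_ (PowerSeries.min_order_le_order_add _ _)
    rw [PowerSeries.order_neg, PowerSeries.order_mul, PowerSeries.order_mul,
      horder u hu hu' hu1, horder v hv hv' hv1, min_self]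
  have hz' : z ≠ 0 := by
    rintro rfl
    have := horder u hu hu' hu1
    rw [PowerSeries.order_zero, PowerSeries.order_eq_top] at this
    exact hu0 this
  obtain ⟨d, hd⟩ := ENat.ne_top_iff_exists.1 (PowerSeries.order_finite_iff_ne_zero.2 hz' |>.ne)
  rw [← hd] at hle
  have hd0 : d = 0 := by
    have : d + d ≤ d := by exact_mod_cast hle
    omega
  have := PowerSeries.coeff_order hz'
  rw [← hd, hd0] at this
  exact this hz0

end NCPoly

end FreeGroups

/-! ### Groups generated by two elements and local rank -/

/-- A free group that is generated by `a, b, c, d`, with `⟨a, b⟩ ∩ ⟨c, d⟩` not abelian, is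
generated by two elements. -/
theorem IsFreeGroup.exists_closure_pair_eq_top {F : Type*} [Group F] [IsFreeGroup F]
    {g : Fin 4 → F} (hg : Subgroup.closure (Set.range g) = ⊤) {u v : F}
    (hu : u ∈ Subgroup.closure {g 0, g 1}) (hu' : u ∈ Subgroup.closure {g 2, g 3})
    (hv : v ∈ Subgroup.closure {g 0, g 1}) (hv' : v ∈ Subgroup.closure {g 2, g 3})
    (huv : u * v ≠ v * u) : ∃ x y : F, Subgroup.closure {x, y} = ⊤ := by
  let ψ : F ≃* FreeGroup (IsFreeGroup.Generators F) := (IsFreeGroup.toFreeGroup F)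
  have mem_pair : ∀ {w : F} {i j : Fin 4}, w ∈ Subgroup.closure {g i, g j} →
      ψ w ∈ Subgroup.closure {ψ (g i), ψ (g j)} := by
    intro w i j hw
    rw [← Set.image_pair ψ]
    have := Subgroup.mem_map_of_mem ψ.toMonoidHom hw
    rwa [MonoidHom.map_closure] at this
  have no_three : ∀ e : Fin 3 → IsFreeGroup.Generators F, ¬ Function.Injective e := by
    intro e he
    refine huv (ψ.injective ?_)
    rw [map_mul, map_mul]
    refine NCPoly.commute_of_mem_closure_pairs (g := ψ ∘ g) ?_ he (mem_pair hu) (mem_pair hu')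
      (mem_pair hv) (mem_pair hv')
    have := congrArg (Subgroup.map ψ.toMonoidHom) hg
    rw [MonoidHom.map_closure, Subgroup.map_top_of_surjective _ ψ.surjective] at this
    rwa [Set.range_comp]
  have of_range : ∀ a b : FreeGroup (IsFreeGroup.Generators F),
      (∀ x, FreeGroup.of x = a ∨ FreeGroup.of x = b) →
      ∃ x y : F, Subgroup.closure {x, y} = ⊤ := by
    intro a b h
    refine ⟨ψ.symm a, ψ.symm b, ?_⟩
    have htop : Subgroup.closure {a, b} = ⊤ := by
      rw [eq_top_iff, ← FreeGroup.closure_range_of, Subgroup.closure_le]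
      rintro _ ⟨x, rfl⟩
      refine Subgroup.subset_closure ?_
      simpa using h x
    have := congrArg (Subgroup.map ψ.symm.toMonoidHom) htop
    rw [MonoidHom.map_closure, Subgroup.map_top_of_surjective _ ψ.symm.surjective] at this
    rw [← Set.image_pair ψ.symm]
    exact this
  -- The basis has at most two elements; missing ones are replaced by `1`.
  by_cases hX : ∃ a b : IsFreeGroup.Generators F, a ≠ b
  · obtain ⟨a, b, hab⟩ := hX
    refine of_range (FreeGroup.of a) (FreeGroup.of b) fun x => ?_
    by_contra! hx
    refine no_three ![a, b, x] ?_
    have hxa : x ≠ a := fun h => hx.1 (by rw [h])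
    have hxb : x ≠ b := fun h => hx.2 (by rw [h])
    intro i j hij
    fin_cases i <;> fin_cases j <;> simp_all
  · push Not at hX
    by_cases hne : Nonempty (IsFreeGroup.Generators F)
    · obtain ⟨a⟩ := hne
      exact of_range (FreeGroup.of a) 1 fun x => Or.inl (by rw [hX x a])
    · exact of_range 1 1 fun x => absurd ⟨x⟩ hne

/-! ### Rank two, local rank and finite subsets -/

theorem HasRank.commute_of_le_one {G : Type*} [Group G] {r : ℕ} (h : HasRank G r) (hr : r ≤ 1)
    (x y : G) : x * y = y * x := by
  obtain ⟨hfg, rfl⟩ := h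
  obtain ⟨S, hS, htop⟩ := Group.rank_spec G
  obtain ⟨s, hs⟩ : ∃ s : G, (S : Set G) ⊆ {s} := by
    obtain ⟨s, hs⟩ := Finset.card_le_one_iff_subset_singleton.1 (hS.trans_le hr)
    exact ⟨s, by exact_mod_cast hs⟩
  have hmem : ∀ x : G, x ∈ Subgroup.zpowers s := fun x => by
    rw [Subgroup.zpowers_eq_closure]
    exact Subgroup.closure_mono hs (by rw [htop]; trivial)
  obtain ⟨m, rfl⟩ := hmem x
  obtain ⟨n, rfl⟩ := hmem y
  exact (Commute.refl s).zpow_zpow m n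

theorem hasRank_two_of_closure_pair {G : Type*} [Group G] {x y : G}
    (h : Subgroup.closure {x, y} = ⊤) {u v : G} (huv : u * v ≠ v * u) : HasRank G 2 := by
  classical
  have hS : Subgroup.closure (({x, y} : Finset G) : Set G) = ⊤ := by simpa using h
  have hfg : Group.FG G := Group.fg_def.2 ⟨{x, y}, hS⟩
  refine ⟨hfg, le_antisymm ((Group.rank_le hS).trans Finset.card_le_two) ?_⟩
  by_contra hlt
  exact huv (HasRank.commute_of_le_one ⟨hfg, rfl⟩ (by omega) u v)

theorem HasRank.exists_closure_pair {G : Type*} [Group G] (h : HasRank G 2) :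
    ∃ x y : G, Subgroup.closure {x, y} = ⊤ := by
  classical
  obtain ⟨hfg, hr⟩ := h
  obtain ⟨S, hS, htop⟩ := Group.rank_spec G
  rw [hr] at hS
  obtain ⟨x, y, -, rfl⟩ := Finset.card_eq_two.1 hS
  exact ⟨x, y, by simpa using htop⟩

/-- A finite infimum of natural numbers is attained: some admissible `s` is below `r + 1`, and
minimality gives `s = r`. -/
theorem exists_hasRank_of_localRank_eq {G : Type*} [Group G] {r : ℕ} (h : localRank G = r)
    (C : Subgroup G) (hC : C.FG) : ∃ D : Subgroup G, C ≤ D ∧ HasRank D r := by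
  have hlt : localRank G < (r + 1 : ℕ) := by rw [h]; exact_mod_cast Nat.lt_succ_self r
  simp only [localRank, iInf_lt_iff] at hlt
  obtain ⟨s, hs, hsr⟩ := hlt
  have hle : localRank G ≤ s := iInf₂_le s hs
  rw [h] at hle
  obtain rfl : s = r := by
    have h1 : s < r + 1 := by exact_mod_cast hsr
    have h2 : r ≤ s := by exact_mod_cast hle
    omega
  exact hs C hC

/-- A finite subset of a subgroup of local rank two lies in a two-generator subgroup of it. -/
theorem exists_closure_pair_of_localRank_eq_two {Γ : Type*} [Group Γ] {A : Subgroup Γ}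
    (hA : localRank A = 2) {S : Set Γ} (hS : S.Finite) (hSA : S ⊆ A) :
    ∃ a b : Γ, Subgroup.closure {a, b} ≤ A ∧ S ⊆ Subgroup.closure {a, b} := by
  have hfin : (A.subtype ⁻¹' S).Finite := hS.preimage A.subtype_injective.injOn
  obtain ⟨D, hCD, hD⟩ := exists_hasRank_of_localRank_eq (r := 2) hA
    (Subgroup.closure (A.subtype ⁻¹' S)) ⟨hfin.toFinset, by simp⟩
  obtain ⟨x, y, hxy⟩ := hD.exists_closure_pair
  have hmap : Subgroup.closure {((x : A) : Γ), ((y : A) : Γ)} = D.map A.subtype := by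
    have := congrArg (fun E => (E.map D.subtype).map A.subtype) hxy
    simp only [MonoidHom.map_closure, Set.image_pair] at this
    rw [← MonoidHom.range_eq_map, Subgroup.range_subtype] at this
    exact this
  refine ⟨x, y, ?_, fun s hs => ?_⟩
  · rw [hmap]
    exact Subgroup.map_subtype_le D
  · rw [hmap]
    exact ⟨⟨s, hSA hs⟩, hCD (Subgroup.subset_closure hs), rfl⟩

theorem Subgroup.exists_finite_subset_of_mem_closure {G : Type*} [Group G] {S : Set G} {x : G}
    (hx : x ∈ Subgroup.closure S) : ∃ T ⊆ S, T.Finite ∧ x ∈ Subgroup.closure T := by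
  induction hx using Subgroup.closure_induction with
  | mem x hx => exact ⟨{x}, by simpa using hx, Set.finite_singleton x,
      Subgroup.subset_closure rfl⟩
  | one => exact ⟨∅, Set.empty_subset _, Set.finite_empty, one_mem _⟩
  | mul x y _ _ hx hy =>
    obtain ⟨T, hTS, hT, hxT⟩ := hx
    obtain ⟨T', hTS', hT', hyT⟩ := hy
    exact ⟨T ∪ T', Set.union_subset hTS hTS', hT.union hT',
      mul_mem (Subgroup.closure_mono Set.subset_union_left hxT)
        (Subgroup.closure_mono Set.subset_union_right hyT)⟩
  | inv x _ hx =>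
    obtain ⟨T, hTS, hT, hxT⟩ := hx
    exact ⟨T, hTS, hT, inv_mem hxT⟩

theorem Subgroup.FG.exists_finite_subset_le_closure {G : Type*} [Group G] {S : Set G}
    {C : Subgroup G} (hC : C.FG) (hCS : C ≤ Subgroup.closure S) :
    ∃ T ⊆ S, T.Finite ∧ C ≤ Subgroup.closure T := by
  obtain ⟨s, rfl⟩ := hC
  choose! T hTS hT hxT using fun x (hx : x ∈ s) =>
    Subgroup.exists_finite_subset_of_mem_closure (hCS (Subgroup.subset_closure hx))
  refine ⟨⋃ x ∈ s, T x, Set.iUnion₂_subset hTS, s.finite_toSet.biUnion hT, ?_⟩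
  rw [Subgroup.closure_le]
  exact fun x hx => Subgroup.closure_mono (Set.subset_biUnion_of_mem hx) (hxT x hx)

/-- In a `4`-free group, two two-generator subgroups with non-abelian intersection generate a
subgroup of rank two. -/
theorem IsKFree.exists_closure_pair_eq {Γ : Type*} [Group Γ] (hΓ : IsKFree 4 Γ) {a b c d u v : Γ}
    (hu : u ∈ Subgroup.closure {a, b}) (hu' : u ∈ Subgroup.closure {c, d})
    (hv : v ∈ Subgroup.closure {a, b}) (hv' : v ∈ Subgroup.closure {c, d})
    (huv : u * v ≠ v * u) :
    ∃ x y : Γ, Subgroup.closure {x, y} = Subgroup.closure {a, b} ⊔ Subgroup.closure {c, d} := by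
  classical
  let g : Fin 4 → Γ := ![a, b, c, d]
  have hrange : Set.range g = {a, b} ∪ {c, d} := by
    ext x
    simp only [g, Set.mem_range, Fin.exists_fin_succ, Set.mem_union, Set.mem_insert_iff,
      Set.mem_singleton_iff]
    simp [eq_comm, or_assoc]
  rw [← Subgroup.closure_union, ← hrange]
  set G := Subgroup.closure (Set.range g) with hG
  have hGfg : Group.FG G := Group.closure_finite_fg _
  have hfree : IsFreeGroup G := by
    refine hΓ G _ ⟨hGfg, rfl⟩ ?_
    have := Subgroup.rank_closure_finite_le_nat_card (Set.range g)
    exact this.trans (by simpa using Finite.card_range_le g)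
  have hmemG : ∀ i, g i ∈ G := fun i => Subgroup.subset_closure ⟨i, rfl⟩
  let g' : Fin 4 → G := fun i => ⟨g i, hmemG i⟩
  have hg' : Subgroup.closure (Set.range g') = ⊤ := by
    refine Subgroup.map_injective G.subtype_injective ?_
    rw [MonoidHom.map_closure, ← Set.range_comp, ← MonoidHom.range_eq_map, Subgroup.range_subtype]
    rfl
  have lift_mem : ∀ {w : Γ} {i j : Fin 4}, w ∈ Subgroup.closure {g i, g j} →
      ∃ hw : w ∈ G, (⟨w, hw⟩ : G) ∈ Subgroup.closure {g' i, g' j} := by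
    intro w i j hw
    have : Subgroup.closure {g i, g j} = (Subgroup.closure {g' i, g' j}).map G.subtype := by
      rw [MonoidHom.map_closure, Set.image_pair]
      rfl
    rw [this] at hw
    obtain ⟨w', hw', rfl⟩ := hw
    exact ⟨w'.2, hw'⟩
  obtain ⟨huG, hu1⟩ := lift_mem (i := 0) (j := 1) hu
  obtain ⟨_, hu2⟩ := lift_mem (i := 2) (j := 3) hu'
  obtain ⟨hvG, hv1⟩ := lift_mem (i := 0) (j := 1) hv
  obtain ⟨_, hv2⟩ := lift_mem (i := 2) (j := 3) hv'
  obtain ⟨x, y, hxy⟩ := IsFreeGroup.exists_closure_pair_eq_top hg' hu1 hu2 hv1 hv2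
    (fun h => huv (congrArg Subtype.val h))
  refine ⟨x, y, ?_⟩
  have := congrArg (Subgroup.map G.subtype) hxy
  rw [MonoidHom.map_closure, Set.image_pair, ← MonoidHom.range_eq_map,
    Subgroup.range_subtype] at this
  exact this

theorem mainTheorem8 {Γ : Type*} [Group Γ] (hΓ : IsKFree 4 Γ) (A B : Subgroup Γ)
    (hA : localRank A = 2) (hB : localRank B = 2)
    (hAB : ∃ u ∈ A ⊓ B, ∃ v ∈ A ⊓ B, u * v ≠ v * u) :
    localRank (A ⊔ B : Subgroup Γ) = 2 := by
  obtain ⟨u, hu, v, hv, huv⟩ := hAB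
  have huv' : (⟨u, le_sup_left (b := B) hu.1⟩ * ⟨v, le_sup_left (b := B) hv.1⟩ :
      (A ⊔ B : Subgroup Γ)) ≠ ⟨v, le_sup_left (b := B) hv.1⟩ * ⟨u, le_sup_left (b := B) hu.1⟩ :=
    fun h => huv (congrArg Subtype.val h)
  refine le_antisymm (iInf₂_le 2 fun C hC => ?_) (le_iInf₂ fun r hr => ?_)
  · have hle : C.map (A ⊔ B).subtype ≤ Subgroup.closure (A ∪ B) := by
      rw [← Subgroup.sup_eq_closure]
      exact Subgroup.map_subtype_le C
    have hCfg : (C.map (A ⊔ B).subtype).FG := by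
      obtain ⟨S, hS⟩ := (Subgroup.fg_iff _).1 hC
      exact (Subgroup.fg_iff _).2 ⟨_, by rw [← hS.1, MonoidHom.map_closure], hS.2.image _⟩
    obtain ⟨T, hTAB, hT, hCT⟩ := Subgroup.FG.exists_finite_subset_le_closure hCfg hle
    -- Adjoining `u, v` here and for `B` keeps the intersection of the two-generator subgroups
    -- non-abelian.
    obtain ⟨a, b, habA, hab⟩ := exists_closure_pair_of_localRank_eq_two hA
      (S := (T ∩ A) ∪ {u, v}) ((hT.inter_of_left _).union (by simp))
      (Set.union_subset Set.inter_subset_right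
        (Set.insert_subset hu.1 (Set.singleton_subset_iff.2 hv.1)))
    obtain ⟨c, d, hcdB, hcd⟩ := exists_closure_pair_of_localRank_eq_two hB
      (S := (T ∩ B) ∪ {u, v}) ((hT.inter_of_left _).union (by simp))
      (Set.union_subset Set.inter_subset_right
        (Set.insert_subset hu.2 (Set.singleton_subset_iff.2 hv.2)))
    obtain ⟨x, y, hxy⟩ := hΓ.exists_closure_pair_eq (hab (by simp)) (hcd (by simp))
      (hab (by simp)) (hcd (by simp)) huv
    have hG : Subgroup.closure {x, y} ≤ A ⊔ B := by
      rw [hxy]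
      exact sup_le_sup habA hcdB
    have hTG : T ⊆ Subgroup.closure {x, y} := by
      intro t ht
      rw [hxy]
      rcases hTAB ht with h | h
      · exact le_sup_left (a := Subgroup.closure {a, b}) (hab (Or.inl ⟨ht, h⟩))
      · exact le_sup_right (a := Subgroup.closure {a, b}) (hcd (Or.inl ⟨ht, h⟩))
    have hmemx : x ∈ A ⊔ B := hG (Subgroup.subset_closure (by simp))
    have hmemy : y ∈ A ⊔ B := hG (Subgroup.subset_closure (by simp))
    let D : Subgroup (A ⊔ B : Subgroup Γ) := Subgroup.closure {⟨x, hmemx⟩, ⟨y, hmemy⟩}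
    have hD : D.map (A ⊔ B).subtype = Subgroup.closure {x, y} := by
      rw [MonoidHom.map_closure, Set.image_pair]
      rfl
    have hmemD : ∀ {w} (hw : w ∈ A ⊔ B), w ∈ Subgroup.closure {x, y} →
        (⟨w, hw⟩ : (A ⊔ B : Subgroup Γ)) ∈ D := by
      intro w hw h
      rw [← hD] at h
      obtain ⟨w', hw', rfl⟩ := h
      exact hw'
    refine ⟨D, fun w hw => ?_, ?_⟩
    · exact hmemD w.2 ((Subgroup.closure_le _).2 hTG (hCT ⟨w, hw, rfl⟩))
    · have hxy' : Subgroup.closure {(⟨⟨x, hmemx⟩, Subgroup.subset_closure (by simp)⟩ : D),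
          ⟨⟨y, hmemy⟩, Subgroup.subset_closure (by simp)⟩} = ⊤ := by
        refine Subgroup.map_injective D.subtype_injective ?_
        rw [MonoidHom.map_closure, Set.image_pair, ← MonoidHom.range_eq_map,
          Subgroup.range_subtype]
        rfl
      -- Two generators bound the rank by two; the non-commuting `u, v` in `D` make it exactly two.
      refine hasRank_two_of_closure_pair hxy'
        (u := ⟨⟨u, le_sup_left (b := B) hu.1⟩, hmemD _ ?_⟩)
        (v := ⟨⟨v, le_sup_left (b := B) hv.1⟩, hmemD _ ?_⟩)
        (fun h => huv' (congrArg Subtype.val h))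
      · rw [hxy]; exact le_sup_left (a := Subgroup.closure {a, b}) (hab (by simp))
      · rw [hxy]; exact le_sup_left (a := Subgroup.closure {a, b}) (hab (by simp))
  -- No subgroup of rank at most one contains both `u` and `v`, as it would be cyclic.
  · obtain ⟨D, hCD, hD⟩ := hr (Subgroup.closure {⟨u, le_sup_left (b := B) hu.1⟩,
      ⟨v, le_sup_left (b := B) hv.1⟩}) ((Subgroup.fg_iff _).2 ⟨_, rfl, by simp⟩)
    by_contra hlt
    have hr1 : r ≤ 1 := by
      have : r < 2 := by exact_mod_cast not_le.1 hlt
      omega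
    exact huv' (congrArg Subtype.val (hD.commute_of_le_one hr1
      ⟨_, hCD (Subgroup.subset_closure (by simp))⟩ ⟨_, hCD (Subgroup.subset_closure (by simp))⟩))
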